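/- Let $k$ be a field and let $G$ be a finite simple graph with vertex set $\{x_1,\dots,x_n\}$. Let $I(G)=\langle x_ix_j \mid \{x_i,x_j\}\in E(G)\rangle\subseteq k[x_1,\dots,x_n]$ be its edge ideal and $X=\mathcal V(I(G))\subseteq k^n$ the set of common zeros of $I(G)$ in $k^n$. The irreducible components of $X$ are its maximal irreducible (Zariski closed) subvarieties. For $p\in X$, let $\dim_p X$ be the maximal dimension of an irreducible component $F$ of $X$ containing $p$, where $\dim F$ is the Krull dimension of $k[x_1,\dots,x_n]/\mathcal I(F)$ and $\mathcal I(F)$ denotes the ideal of all polynomials vanishing on $F$. Let $$T_pX=\Big\{v\in k^n \;\Big|\; \sum_{i=1}^n \frac{\partial f}{\partial x_i}(p)\,v_i=0 \text{ for all } f\in\mathcal I(X)\Big\}$$ be the tangent space. The point $p$ is called singular if $\dim_k T_pX\neq\dim_pX$. Then a point $p\in X$ is singular if and only if it lies on the intersection of two or more (distinct) irreducible components of $X$. Moreover, if $k$ is infinite, the irreducible components of $X$ are exactly the coordinate subspaces $\mathcal V(\langle W\rangle)=\{a\in k^n \mid a_i=0 \text{ for all } x_i\in W\}$, where $W$ runs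 over the minimal vertex covers of $G$. -/

import Mathlib

namespace EdgeVariety

open MvPolynomial

/-- The edge ideal `I(G) = ⟨x_i x_j | {i, j} ∈ E(G)⟩` in the polynomial ring `k[x_v | v ∈ V(G)]`. -/
noncomputable def edgeIdeal (k : Type*) [Field k] {σ : Type*} (G : SimpleGraph σ) :
    Ideal (MvPolynomial σ k) :=
  Ideal.span {f | ∃ i j, G.Adj i j ∧ f = X i * X j}

/-- The variety `𝒱(I(G))` in the affine space `k^n`. -/
noncomputable def edgeVariety (k : Type*) [Field k] {σ : Type*} (G : SimpleGraph σ) : Set (σ → k) :=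
  zeroLocus k (edgeIdeal k G)

/-- The coordinate subspace `𝒱(⟨x_i | i ∈ W⟩)` of affine space. -/
def coordSubspace (k : Type*) [Field k] {σ : Type*} (W : Set σ) : Set (σ → k) :=
  zeroLocus k (Ideal.span ((fun i => (X i : MvPolynomial σ k)) '' W))

/-- A subset of affine space is an affine variety (Zariski closed) if it is the common zero set of
the polynomials in some ideal. -/
def IsAffineVariety {k σ : Type*} [Field k] (S : Set (σ → k)) : Prop :=
  ∃ I : Ideal (MvPolynomial σ k), S = zeroLocus k I

/-- An irreducible variety: nonempty and not the union of two proper subvarieties. -/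
def IsIrreducibleVariety {k σ : Type*} [Field k] (F : Set (σ → k)) : Prop :=
  IsAffineVariety F ∧ F.Nonempty ∧
    ∀ A B : Set (σ → k), IsAffineVariety A → IsAffineVariety B → F = A ∪ B → F = A ∨ F = B

/-- The irreducible components of `S`: its maximal irreducible subvarieties. -/
def components {k σ : Type*} [Field k] (S : Set (σ → k)) : Set (Set (σ → k)) :=
  {F | Maximal (fun T => IsIrreducibleVariety T ∧ T ⊆ S) F}

/-- The dimension of a variety: the Krull dimension of its coordinate ring `k[x] / ℐ(F)`. -/
noncomputable def varietyDim {k σ : Type*} [Field k] (F : Set (σ → k)) : WithBot ℕ∞ :=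
  ringKrullDim (MvPolynomial σ k ⧸ vanishingIdeal k F)

/-- The local dimension `dim_p S`: the largest dimension of an irreducible component of `S`
containing `p`. -/
noncomputable def localDim {k σ : Type*} [Field k] (S : Set (σ → k)) (p : σ → k) : WithBot ℕ∞ :=
  ⨆ F ∈ {F | F ∈ components S ∧ p ∈ F}, varietyDim F

/-- The tangent space `T_p S`, translated to the origin: the common zeros of the linear parts at `p`
`∑ i, ∂f/∂x_i(p) v_i` of all polynomials `f` vanishing on `S`. -/
noncomputable def tangentSpace {k σ : Type*} [Field k] [Fintype σ] (S : Set (σ → k)) (p : σ → k) :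
    Submodule k (σ → k) where
  carrier := {v | ∀ f ∈ vanishingIdeal k S, ∑ i, eval p (pderiv i f) * v i = 0}
  add_mem' := by
    intro a b ha hb f hf
    simp only [Pi.add_apply, mul_add, Finset.sum_add_distrib, ha f hf, hb f hf, add_zero]
  zero_mem' := by
    intro f _
    simp
  smul_mem' := by
    intro c v hv f hf
    simp only [Pi.smul_apply, smul_eq_mul, mul_left_comm _ c, ← Finset.mul_sum, hv f hf, mul_zero]

/-- A point `p` of a variety `S` is nonsingular if `dim T_p S = dim_p S`, and singular otherwise. -/
def IsSingularPoint {k σ : Type*} [Field k] [Fintype σ] (S : Set (σ → k)) (p : σ → k) : Prop :=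
  p ∈ S ∧ (Module.finrank k (tangentSpace S p) : WithBot ℕ∞) ≠ localDim S p

end EdgeVariety

namespace EdgeVariety

open MvPolynomial

/-! ### Prime vanishing ideals and coordinate subspaces -/

section Varieties

variable {k σ : Type*} [Field k]

/-! Let `k` be infinite. Coordinate subspaces are then irreducible, and the variables vanishing on
an irreducible subvariety of `X` form a vertex cover because its ideal is prime; this gives
`components_edgeVariety`. For `p` in `X`, let `N` be the set of neighbors of the support of `p`. By
`tangentSpace_edgeVariety`, `T_p X` is the coordinate subspace on which `N` vanishes, so its
dimension is `n - |N|`. The local dimension is the maximum of `n - |W|` over the minimal covers `W`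
whose subspace contains `p`, and `N` is the intersection of these `W` (`supportNeighbors_subset`,
`exists_minimal_cover_notMem`). The two numbers agree iff some such `W` equals `N`, and by
minimality this means that there is only one such `W`. Over a finite field, components are points
and tangent spaces are zero, so neither side of the equivalence ever holds. -/

theorem IsAffineVariety.inter {A B : Set (σ → k)} (hA : IsAffineVariety A)
    (hB : IsAffineVariety B) : IsAffineVariety (A ∩ B) := by
  obtain ⟨I, rfl⟩ := hA
  obtain ⟨J, rfl⟩ := hB
  exact ⟨I ⊔ J, (zeroLocus_vanishingIdeal_galoisConnection (k := k) (K := k)).l_sup.symm⟩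

theorem isAffineVariety_setOf_aeval_eq_zero (f : MvPolynomial σ k) :
    IsAffineVariety {x : σ → k | aeval x f = 0} :=
  ⟨Ideal.span {f}, by simp [zeroLocus_span]⟩

/-- A variety is irreducible exactly when its vanishing ideal is prime. -/
theorem isIrreducibleVariety_iff_isPrime {F : Set (σ → k)} (hF : IsAffineVariety F) :
    IsIrreducibleVariety F ↔ (vanishingIdeal k F).IsPrime := by
  constructor
  · rintro ⟨-, ⟨x, hx⟩, hirr⟩
    refine Ideal.isPrime_iff.2 ⟨fun h => ?_, fun {f g} hfg => ?_⟩
    · have h1 : (1 : MvPolynomial σ k) ∈ vanishingIdeal k F := h ▸ Submodule.mem_top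
      simpa using h1 x hx
    · have hcover : F = F ∩ {x | aeval x f = 0} ∪ F ∩ {x | aeval x g = 0} := by
        rw [← Set.inter_union_distrib_left, eq_comm, Set.inter_eq_left]
        intro y hy
        simpa using hfg y hy
      exact (hirr _ _ (hF.inter (isAffineVariety_setOf_aeval_eq_zero f))
        (hF.inter (isAffineVariety_setOf_aeval_eq_zero g)) hcover).imp
          (fun h y hy => (h ▸ hy).2) (fun h y hy => (h ▸ hy).2)
  · intro hp
    refine ⟨hF, Set.nonempty_iff_ne_empty.2 fun h => hp.ne_top (h ▸ vanishingIdeal_empty), ?_⟩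
    rintro A B ⟨I, rfl⟩ ⟨J, rfl⟩ hAB
    have hle : I ⊓ J ≤ vanishingIdeal k F := by
      rintro f ⟨hI, hJ⟩ x hx
      rw [hAB] at hx
      exact hx.elim (fun h => h f hI) (fun h => h f hJ)
    refine (hp.inf_le.1 hle).imp (fun h => ?_) (fun h => ?_)
    · exact (le_zeroLocus_iff_le_vanishingIdeal.2 h).antisymm
        (Set.subset_union_left.trans hAB.ge)
    · exact (le_zeroLocus_iff_le_vanishingIdeal.2 h).antisymm
        (Set.subset_union_right.trans hAB.ge)

theorem IsIrreducibleVariety.isPrime {F : Set (σ → k)} (hF : IsIrreducibleVariety F) :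
    (vanishingIdeal k F).IsPrime :=
  (isIrreducibleVariety_iff_isPrime hF.1).1 hF

theorem mem_edgeVariety {G : SimpleGraph σ} {a : σ → k} :
    a ∈ edgeVariety k G ↔ ∀ i j, G.Adj i j → a i = 0 ∨ a j = 0 := by
  rw [edgeVariety, edgeIdeal, zeroLocus_span]
  constructor
  · intro h i j hij
    simpa using h _ ⟨i, j, hij, rfl⟩
  · rintro h _ ⟨i, j, hij, rfl⟩
    simpa using h i j hij

theorem mem_coordSubspace {W : Set σ} {a : σ → k} :
    a ∈ coordSubspace k W ↔ ∀ i ∈ W, a i = 0 := by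
  rw [coordSubspace, zeroLocus_span]
  simp

theorem sum_eval_pderiv_X_mul [Fintype σ] (p v : σ → k) (j : σ) :
    ∑ i, eval p (pderiv i (X j)) * v i = v j := by
  classical
  rw [Finset.sum_eq_single j (fun i _ hij => by simp [pderiv_X_of_ne hij.symm]) (by simp)]
  simp

theorem coordSubspace_subset_iff {W W' : Set σ} :
    coordSubspace k W ⊆ coordSubspace k W' ↔ W' ⊆ W := by
  classical
  constructor
  · intro h i hi
    by_contra hiW
    have hmem : Pi.single i (1 : k) ∈ coordSubspace k W := by
      refine mem_coordSubspace.2 fun j hj => Pi.single_eq_of_ne ?_ _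
      rintro rfl
      exact hiW hj
    simpa using mem_coordSubspace.1 (h hmem) i hi
  · intro h a ha
    exact mem_coordSubspace.2 fun i hi => mem_coordSubspace.1 ha i (h hi)

theorem coordSubspace_injective : Function.Injective (coordSubspace k : Set σ → _) :=
  fun _ _ h => (coordSubspace_subset_iff.1 h.ge).antisymm (coordSubspace_subset_iff.1 h.le)

theorem coordSubspace_subset_edgeVariety {G : SimpleGraph σ} {W : Set σ}
    (hW : G.IsVertexCover W) : coordSubspace k W ⊆ edgeVariety k G := fun _ ha =>
  mem_edgeVariety.2 fun _ _ hij =>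
    (hW hij).imp (mem_coordSubspace.1 ha _) (mem_coordSubspace.1 ha _)

end Varieties

/-! ### Infinite fields: components -/

section Infinite

variable {k σ : Type*} [Field k]

open Classical in
/-- Restriction of polynomials to the coordinate subspace where the variables in `W` vanish. -/
noncomputable def restrictCoord (k : Type*) [Field k] {σ : Type*} (W : Set σ) :
    MvPolynomial σ k →ₐ[k] MvPolynomial (Wᶜ : Set σ) k :=
  aeval fun i => if h : i ∈ Wᶜ then X ⟨i, h⟩ else 0

theorem restrictCoord_surjective (W : Set σ) : Function.Surjective (restrictCoord k W) := by
  intro f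
  refine ⟨rename (↑) f, ?_⟩
  rw [restrictCoord, aeval_rename]
  conv_rhs => rw [← aeval_X_left_apply f]
  congr 2
  funext i
  exact dif_pos i.2

/-- Over an infinite field only the zero polynomial vanishes everywhere. The coordinate ring of the
subspace is thus a polynomial ring, which yields both its irreducibility and its dimension. -/
theorem ker_restrictCoord [Infinite k] (W : Set σ) :
    RingHom.ker (restrictCoord k W) = vanishingIdeal k (coordSubspace k W) := by
  classical
  have key (f : MvPolynomial σ k) (y : (Wᶜ : Set σ) → k) : eval y (restrictCoord k W f) =
      aeval (fun i => if h : i ∈ Wᶜ then y ⟨i, h⟩ else 0) f := by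
    rw [restrictCoord, ← coe_aeval_eq_eval, RingHom.coe_coe, ← AlgHom.comp_apply, comp_aeval]
    congr 2
    funext i
    split_ifs <;> simp
  ext f
  rw [RingHom.mem_ker]
  constructor
  · intro h x hx
    have := key f fun i => x i
    rw [h, map_zero] at this
    rw [this]
    congr 2
    funext i
    split_ifs with hi
    · rfl
    · exact mem_coordSubspace.1 hx i (not_not.1 hi)
  · intro h
    refine MvPolynomial.funext fun y => ?_
    rw [key, map_zero]
    exact h _ (mem_coordSubspace.2 fun i hi => dif_neg (not_not.2 hi))

theorem isIrreducibleVariety_coordSubspace [Infinite k] (W : Set σ) :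
    IsIrreducibleVariety (coordSubspace k W) := by
  have hW : IsAffineVariety (coordSubspace k W) := ⟨_, rfl⟩
  rw [isIrreducibleVariety_iff_isPrime hW, ← ker_restrictCoord]
  exact RingHom.ker_isPrime _

theorem varietyDim_coordSubspace [Infinite k] [Finite σ] (W : Set σ) :
    varietyDim (coordSubspace k W) = ((Wᶜ.ncard : ℕ) : WithBot ℕ∞) := by
  rw [varietyDim, ← ker_restrictCoord, ringKrullDim_eq_of_ringEquiv
    (Ideal.quotientKerAlgEquivOfSurjective (restrictCoord_surjective (k := k) W)).toRingEquiv,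
    MvPolynomial.ringKrullDim_of_isNoetherianRing, ringKrullDim_eq_zero_of_field, zero_add]
  rfl

/-- An irreducible subvariety of the edge variety lies on the coordinate subspace of a minimal
vertex cover. -/
theorem IsIrreducibleVariety.exists_subset_coordSubspace [Finite σ] {G : SimpleGraph σ}
    {F : Set (σ → k)} (hF : IsIrreducibleVariety F) (hFG : F ⊆ edgeVariety k G) :
    ∃ W, Minimal G.IsVertexCover W ∧ F ⊆ coordSubspace k W := by
  -- Each edge monomial vanishes on `F`, so primality puts one of its two variables in the ideal.
  have hcover : G.IsVertexCover {i | X i ∈ vanishingIdeal k F} := fun i j hij =>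
    hF.isPrime.mem_or_mem fun x hx => by simpa using mem_edgeVariety.1 (hFG hx) i j hij
  obtain ⟨W, hW, hmin⟩ := exists_minimal_le_of_wellFoundedLT G.IsVertexCover _ hcover
  refine ⟨W, hmin, fun x hx => mem_coordSubspace.2 fun i hi => ?_⟩
  simpa using hW hi x hx

theorem components_edgeVariety [Infinite k] [Finite σ] (G : SimpleGraph σ) :
    components (edgeVariety k G) =
      {F | ∃ W : Set σ, Minimal G.IsVertexCover W ∧ F = coordSubspace k W} := by
  ext F
  constructor
  · rintro ⟨⟨hF, hFG⟩, hmax⟩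
    obtain ⟨W, hW, hFW⟩ := hF.exists_subset_coordSubspace hFG
    exact ⟨W, hW, hFW.antisymm (hmax ⟨isIrreducibleVariety_coordSubspace W,
      coordSubspace_subset_edgeVariety hW.1⟩ hFW)⟩
  · rintro ⟨W, hW, rfl⟩
    refine ⟨⟨isIrreducibleVariety_coordSubspace W, coordSubspace_subset_edgeVariety hW.1⟩, ?_⟩
    rintro F ⟨hF, hFG⟩ hWF
    obtain ⟨W', hW', hFW'⟩ := hF.exists_subset_coordSubspace hFG
    have := hW.eq_of_subset hW'.1 (coordSubspace_subset_iff.1 (hWF.trans hFW'))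
    exact this ▸ hFW'

/-! ### Infinite fields: tangent spaces and singular points -/

open Classical in
/-- Restriction of polynomials to the line through `p` in the direction of the `j`-th axis. -/
noncomputable def restrictLine (p : σ → k) (j : σ) : MvPolynomial σ k →ₐ[k] Polynomial k :=
  aeval fun i => Polynomial.C (p i) + if i = j then Polynomial.X else 0

theorem eval_restrictLine [DecidableEq σ] (p : σ → k) (j : σ) (t : k) (f : MvPolynomial σ k) :
    (restrictLine p j f).eval t = eval (p + Pi.single j t) f := by
  induction f using MvPolynomial.induction_on with
  | C a => simp [restrictLine, Polynomial.algebraMap_eq]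
  | add f g hf hg => simp [hf, hg]
  | mul_X f i hf =>
    rw [map_mul, Polynomial.eval_mul, hf, map_mul, eval_X, restrictLine, aeval_X]
    rcases eq_or_ne i j with rfl | hij
    · simp
    · simp [hij]

theorem eval_derivative_restrictLine (p : σ → k) (j : σ) (f : MvPolynomial σ k) :
    (Polynomial.derivative (restrictLine p j f)).eval 0 = eval p (pderiv j f) := by
  classical
  induction f using MvPolynomial.induction_on with
  | C a => simp [restrictLine, Polynomial.algebraMap_eq]
  | add f g hf hg => simp [hf, hg]
  | mul_X f i hf =>
    have hX : restrictLine p j (X i) = Polynomial.C (p i) + if i = j then Polynomial.X else 0 := by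
      rw [restrictLine, aeval_X]
    rw [map_mul, Polynomial.derivative_mul, Polynomial.eval_add, Polynomial.eval_mul,
      Polynomial.eval_mul, hf, hX, eval_restrictLine, Derivation.leibniz, Pi.single_zero, add_zero]
    rcases eq_or_ne i j with rfl | hij
    · simp [mul_comm, add_comm]
    · simp [hij, pderiv_X_of_ne hij, mul_comm]

theorem eval_pderiv_eq_zero_of_vanishing_on_line [Infinite k] [DecidableEq σ] {p : σ → k} {j : σ}
    {f : MvPolynomial σ k} (h : ∀ t : k, aeval (p + Pi.single j t) f = 0) :
    eval p (pderiv j f) = 0 := by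
  have hz : restrictLine p j f = 0 := Polynomial.funext fun t => by
    rw [eval_restrictLine, Polynomial.eval_zero, ← h t, ← coe_aeval_eq_eval, RingHom.coe_coe]
  rw [← eval_derivative_restrictLine, hz, map_zero, Polynomial.eval_zero]

/-- The vertices adjacent to the support of `p`. -/
def supportNeighbors (G : SimpleGraph σ) (p : σ → k) : Set σ :=
  {j | ∃ i, p i ≠ 0 ∧ G.Adj i j}

/-- If `p i ≠ 0` and `j` is adjacent to `i`, then `p j = 0` and the linear part of `X i * X j` at
`p` is `p i * v j`, forcing `v j = 0`. If `j` has no neighbor in the support, the line through `p`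
along axis `j` stays in the variety, so `∂f/∂x_j` vanishes at `p` for every `f` in the ideal. No
generators of the vanishing ideal are needed. -/
theorem tangentSpace_edgeVariety [Infinite k] [Fintype σ] {G : SimpleGraph σ} {p : σ → k}
    (hp : p ∈ edgeVariety k G) :
    tangentSpace (edgeVariety k G) p = Pi.spanSubset k (supportNeighbors G p)ᶜ := by
  classical
  ext v
  rw [Pi.mem_spanSubset_iff]
  constructor
  · rintro hv j hj
    obtain ⟨i, hi, hij⟩ := not_not.1 hj
    have hpj : p j = 0 := (mem_edgeVariety.1 hp i j hij).resolve_left hi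
    have := hv (X i * X j) fun x hx => by simpa using mem_edgeVariety.1 hx i j hij
    simp only [Derivation.leibniz, smul_eq_mul, map_add, map_mul, eval_X, hpj, zero_mul, add_zero,
      mul_assoc, ← Finset.mul_sum, sum_eval_pderiv_X_mul] at this
    exact (mul_eq_zero.1 this).resolve_left hi
  · intro hv f hf
    refine Finset.sum_eq_zero fun j _ => ?_
    by_cases hj : j ∈ supportNeighbors G p
    · rw [hv j (not_not.2 hj), mul_zero]
    rw [eval_pderiv_eq_zero_of_vanishing_on_line, zero_mul]
    refine fun t => hf _ (mem_edgeVariety.2 fun a b hab => ?_)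
    have hab' := mem_edgeVariety.1 hp a b hab
    have hja : a = j → p b = 0 := by
      rintro rfl
      by_contra hb
      exact hj ⟨b, hb, hab.symm⟩
    have hjb : b = j → p a = 0 := by
      rintro rfl
      by_contra ha
      exact hj ⟨a, ha, hab⟩
    have hne := hab.ne
    simp only [Pi.add_apply, Pi.single_apply]
    grind

theorem finrank_tangentSpace_edgeVariety [Infinite k] [Fintype σ] {G : SimpleGraph σ} {p : σ → k}
    (hp : p ∈ edgeVariety k G) :
    Module.finrank k (tangentSpace (edgeVariety k G) p) = (supportNeighbors G p)ᶜ.ncard := by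
  rw [tangentSpace_edgeVariety hp, Pi.dim_spanSubset]

theorem supportNeighbors_subset {G : SimpleGraph σ} {p : σ → k} {W : Set σ}
    (hW : G.IsVertexCover W) (hpW : p ∈ coordSubspace k W) : supportNeighbors G p ⊆ W := by
  rintro j ⟨i, hi, hij⟩
  exact (hW hij).resolve_left fun h => hi (mem_coordSubspace.1 hpW i h)

/-- A vertex not adjacent to the support of `p` is avoided by some minimal vertex cover whose
coordinate subspace contains `p`. -/
theorem exists_minimal_cover_notMem [Finite σ] {G : SimpleGraph σ} {p : σ → k}
    (hp : p ∈ edgeVariety k G) {j : σ} (hj : j ∉ supportNeighbors G p) :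
    ∃ W, Minimal G.IsVertexCover W ∧ p ∈ coordSubspace k W ∧ j ∉ W := by
  -- The zero set of `p` remains a cover without `j`: every neighbor of `j` is a zero of `p`.
  have hcover : G.IsVertexCover {i | p i = 0 ∧ i ≠ j} := by
    intro a b hab
    have := mem_edgeVariety.1 hp a b hab
    have hne := hab.ne
    have h1 : a = j → p b = 0 := by
      rintro rfl
      by_contra hb
      exact hj ⟨b, hb, hab.symm⟩
    have h2 : b = j → p a = 0 := by
      rintro rfl
      by_contra ha
      exact hj ⟨a, ha, hab⟩
    simp only [Set.mem_ofPred_eq]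
    grind
  obtain ⟨W, hW, hmin⟩ := exists_minimal_le_of_wellFoundedLT G.IsVertexCover _ hcover
  exact ⟨W, hmin, mem_coordSubspace.2 fun i hi => (hW hi).1, fun h => (hW h).2 rfl⟩

theorem exists_minimal_cover_mem [Finite σ] {G : SimpleGraph σ} {p : σ → k}
    (hp : p ∈ edgeVariety k G) :
    ∃ W, Minimal G.IsVertexCover W ∧ p ∈ coordSubspace k W := by
  have hcover : G.IsVertexCover {i | p i = 0} := fun a b hab => mem_edgeVariety.1 hp a b hab
  obtain ⟨W, hW, hmin⟩ := exists_minimal_le_of_wellFoundedLT G.IsVertexCover _ hcover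
  exact ⟨W, hmin, mem_coordSubspace.2 fun i hi => hW hi⟩

theorem isSingularPoint_iff_of_infinite [Infinite k] [Fintype σ] {G : SimpleGraph σ} {p : σ → k}
    (hp : p ∈ edgeVariety k G) :
    IsSingularPoint (edgeVariety k G) p ↔
      ∃ F₁ ∈ components (edgeVariety k G), ∃ F₂ ∈ components (edgeVariety k G),
        F₁ ≠ F₂ ∧ p ∈ F₁ ∩ F₂ := by
  rw [IsSingularPoint, and_iff_right hp, finrank_tangentSpace_edgeVariety hp, localDim,
    components_edgeVariety]
  obtain ⟨W₀, hW₀, hpW₀⟩ := exists_minimal_cover_mem hp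
  constructor
  · contrapose!
    intro huniq
    have hW₀eq (W : Set σ) (hW : Minimal G.IsVertexCover W) (hpW : p ∈ coordSubspace k W) :
        coordSubspace k W = coordSubspace k W₀ := by
      by_contra hne
      exact huniq _ ⟨W, hW, rfl⟩ _ ⟨W₀, hW₀, rfl⟩ hne ⟨hpW, hpW₀⟩
    have hW₀N : W₀ = supportNeighbors G p := by
      refine Set.Subset.antisymm (fun j hj => ?_) (supportNeighbors_subset hW₀.1 hpW₀)
      by_contra hjN
      obtain ⟨W, hW, hpW, hjW⟩ := exists_minimal_cover_notMem hp hjN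
      exact hjW (coordSubspace_injective (hW₀eq W hW hpW) ▸ hj)
    rw [← hW₀N, ← varietyDim_coordSubspace (k := k)]
    refine le_antisymm (le_iSup₂_of_le _ ⟨⟨W₀, hW₀, rfl⟩, hpW₀⟩ le_rfl) (iSup₂_le ?_)
    rintro _ ⟨⟨W, hW, rfl⟩, hpW⟩
    rw [hW₀eq W hW hpW]
  · rintro ⟨_, ⟨W₁, hW₁, rfl⟩, _, ⟨W₂, hW₂, rfl⟩, hne, hp₁, hp₂⟩
    -- Termwise strict bounds need not survive a supremum, hence a uniform bound one lower. The
    -- truncated subtraction is harmless: if `N` were everything, both covers would be too.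
    refine (lt_of_le_of_lt (b := (((supportNeighbors G p)ᶜ.ncard - 1 : ℕ) : WithBot ℕ∞))
      (iSup₂_le ?_) ?_).ne'
    · rintro _ ⟨⟨W, hW, rfl⟩, hpW⟩
      rw [varietyDim_coordSubspace]
      have hlt : Wᶜ.ncard < (supportNeighbors G p)ᶜ.ncard := by
        refine Set.ncard_lt_ncard (compl_lt_compl_iff_lt.2
          ((supportNeighbors_subset hW.1 hpW).ssubset_of_ne fun h => hne ?_))
        have h₁ := supportNeighbors_subset hW₁.1 hp₁
        have h₂ := supportNeighbors_subset hW₂.1 hp₂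
        rw [h] at h₁ h₂
        rw [← hW₁.eq_of_subset hW.1 h₁, ← hW₂.eq_of_subset hW.1 h₂]
      exact_mod_cast Nat.le_sub_one_of_lt hlt
    · have hpos : 0 < (supportNeighbors G p)ᶜ.ncard := by
        refine (Set.ncard_pos).2 (Set.nonempty_compl.2 fun h => hne ?_)
        have h₁ := supportNeighbors_subset hW₁.1 hp₁
        have h₂ := supportNeighbors_subset hW₂.1 hp₂
        rw [h, Set.univ_subset_iff] at h₁ h₂
        rw [h₁, h₂]
      exact_mod_cast Nat.sub_one_lt hpos.ne'

end Infinite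

/-! ### Finite fields -/

section Finite

variable {k σ : Type*} [Field k]

theorem isIrreducibleVariety_singleton (p : σ → k) : IsIrreducibleVariety {p} := by
  refine (isIrreducibleVariety_iff_isPrime
    ⟨Ideal.span (Set.range fun i => X i - C (p i)), ?_⟩).2 inferInstance
  rw [zeroLocus_span]
  ext x
  simp [sub_eq_zero, funext_iff]

theorem IsIrreducibleVariety.eq_singleton [Finite k] {F : Set (σ → k)}
    (hF : IsIrreducibleVariety F) {p : σ → k} (hp : p ∈ F) : F = {p} := by
  have := Fintype.ofFinite k
  have hprime := hF.isPrime
  refine Set.eq_singleton_iff_unique_mem.2 ⟨hp, fun x hx => funext fun i => ?_⟩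
  -- This product vanishes at every point; a factor lying in the prime ideal makes coordinate `i`
  -- constant on `F`.
  have hprod : ∏ c : k, (X i - C c) ∈ vanishingIdeal k F := fun y _ => by
    rw [map_prod]
    exact Finset.prod_eq_zero (Finset.mem_univ (y i)) (by simp)
  obtain ⟨c, -, hc⟩ := hprime.prod_mem_iff.1 hprod
  have h1 := hc x hx
  have h2 := hc p hp
  simp only [map_sub, aeval_X, aeval_C, Algebra.algebraMap_self, RingHom.id_apply,
    sub_eq_zero] at h1 h2
  rw [h1, h2]

theorem singleton_mem_components [Finite k] {S : Set (σ → k)} {p : σ → k} (hp : p ∈ S) :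
    {p} ∈ components S := by
  refine ⟨⟨isIrreducibleVariety_singleton p, Set.singleton_subset_iff.2 hp⟩, ?_⟩
  rintro F ⟨hF, -⟩ hpF
  exact (hF.eq_singleton (hpF rfl)).le

theorem localDim_of_finite [Finite k] {S : Set (σ → k)} {p : σ → k} (hp : p ∈ S) :
    localDim S p = 0 := by
  have hdim : varietyDim ({p} : Set (σ → k)) = 0 :=
    ringKrullDim_eq_zero_of_isField
      ((Ideal.Quotient.maximal_ideal_iff_isField_quotient _).1 inferInstance)
  refine le_antisymm (iSup₂_le ?_)
    (le_iSup₂_of_le {p} ⟨singleton_mem_components hp, rfl⟩ hdim.ge)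
  rintro F ⟨hF, hpF⟩
  rw [hF.1.1.eq_singleton hpF, hdim]

theorem tangentSpace_of_finite [Finite k] [Fintype σ] (S : Set (σ → k)) (p : σ → k) :
    tangentSpace S p = ⊥ := by
  classical
  have := Fintype.ofFinite k
  refine (Submodule.eq_bot_iff _).2 fun v hv => funext fun j => ?_
  -- The derivative of `X ^ q - X` is `-1`, since `q = 0` in `k`, so the condition reads `-v j = 0`.
  have := hv (X j ^ Fintype.card k - X j) fun x _ => by simp [FiniteField.pow_card]
  simpa [Derivation.leibniz_pow, sum_eval_pderiv_X_mul, -pderiv_X] using this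

theorem not_isSingularPoint_of_finite [Finite k] [Fintype σ] (S : Set (σ → k)) (p : σ → k) :
    ¬ IsSingularPoint S p := by
  rintro ⟨hp, hne⟩
  rw [tangentSpace_of_finite, finrank_bot, localDim_of_finite hp] at hne
  exact hne rfl

end Finite

end EdgeVariety

theorem mainTheorem7 {k σ : Type*} [Field k] [Fintype σ] (G : SimpleGraph σ) :
    (∀ p ∈ EdgeVariety.edgeVariety k G,
      (EdgeVariety.IsSingularPoint (EdgeVariety.edgeVariety k G) p ↔
        ∃ F₁ ∈ EdgeVariety.components (EdgeVariety.edgeVariety k G),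
          ∃ F₂ ∈ EdgeVariety.components (EdgeVariety.edgeVariety k G),
            F₁ ≠ F₂ ∧ p ∈ F₁ ∩ F₂)) ∧
    (Infinite k →
      EdgeVariety.components (EdgeVariety.edgeVariety k G) =
        {F | ∃ W : Set σ, Minimal G.IsVertexCover W ∧ F = EdgeVariety.coordSubspace k W}) := by
  refine ⟨fun p hp => ?_, fun _ => EdgeVariety.components_edgeVariety G⟩
  cases finite_or_infinite k
  · refine iff_of_false (EdgeVariety.not_isSingularPoint_of_finite _ p) ?_
    rintro ⟨F₁, hF₁, F₂, hF₂, hne, hp₁, hp₂⟩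
    exact hne ((hF₁.1.1.eq_singleton hp₁).trans (hF₂.1.1.eq_singleton hp₂).symm)
  · exact EdgeVariety.isSingularPoint_iff_of_infinite hp
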